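/- Let $n\ge 1$ be an integer and let $F(x,z)=\sum_{j=0}^{2n+1} f_j\,x^{2n+1-j}z^j$ be the generic binary form of degree $2n+1$, with indeterminate coefficients $f_0,\dots,f_{2n+1}$ over $\mathbb{Z}$. For binary forms $G,H$ in $x,z$ and $r \ge 0$, define the $r$-th transvectant (without normalizing factors) by $$(G,H)_r=\sum_{i=0}^{r}(-1)^i\binom{r}{i}\,\frac{\partial^r G}{\partial x^{r-i}\,\partial z^{i}}\;\frac{\partial^r H}{\partial x^{i}\,\partial z^{r-i}}.$$ Write the quadratic covariant of $F$ as $(F,F)_{2n}=A_nx^2+B_nxz+C_nz^2$ with $A_n,B_n,C_n\in\mathbb{Z}[f_0,\dots,f_{2n+1}]$, put $\Delta_n=B_n^2-4A_nC_n\in\mathbb{Z}[f_0,\dots,f_{2n+1}]$, and let $S(n)\ge 0$ be the content of $\Delta_n$, that is, the greatest common divisor of its integer coefficients. Then $S(n)\neq 0$, and for the $p$-adic valuations $v_p(S(n))$ the following hold. (i) $v_2(S(n))$ is even. (ii) For every odd prime $p$, $v_p(S(n))$ is odd if and only if $n+2$ is a power of $p$. Equivalently, the squarefree part of $S(n)$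 (the squarefree positive integer $d$ for which $S(n)/d$ is a perfect square) equals $p$ if $n+2=p^k$ for an odd prime $p$ and an integer $k\ge 1$, and equals $1$ otherwise. -/

import Mathlib

namespace QuarticInvariant

open MvPolynomial

/-- The mixed partial derivative `∂^(a+b) G / ∂x^a ∂z^b` of a polynomial `G` in the two variables
`x = X 0` and `z = X 1`. -/
noncomputable def partialXZ {R : Type*} [CommRing R] (a b : ℕ) (G : MvPolynomial (Fin 2) R) :
    MvPolynomial (Fin 2) R :=
  (⇑(pderiv (R := R) (0 : Fin 2)))^[a] ((⇑(pderiv (R := R) (1 : Fin 2)))^[b] G)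

/-- The `r`-th transvectant of two binary forms, with no normalizing factor:
`(G, H)_r = ∑_{i=0}^r (-1)^i binom(r,i) (∂^r G / ∂x^(r-i) ∂z^i) (∂^r H / ∂x^i ∂z^(r-i))`. -/
noncomputable def transvectant {R : Type*} [CommRing R] (r : ℕ) (G H : MvPolynomial (Fin 2) R) :
    MvPolynomial (Fin 2) R :=
  ∑ i ∈ Finset.range (r + 1),
    (-1) ^ i * (r.choose i : MvPolynomial (Fin 2) R) * partialXZ (r - i) i G * partialXZ i (r - i) H

/-- The coefficient ring `ℤ[f_0, …, f_{2n+1}]`. -/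
abbrev CoeffRing (n : ℕ) : Type := MvPolynomial (Fin (2 * n + 2)) ℤ

/-- The generic binary form `F = ∑_{j=0}^{2n+1} f_j x^(2n+1-j) z^j` of degree `2n+1`. -/
noncomputable def genericForm (n : ℕ) : MvPolynomial (Fin 2) (CoeffRing n) :=
  ∑ j : Fin (2 * n + 2), C (X j : CoeffRing n) * X 0 ^ (2 * n + 1 - (j : ℕ)) * X 1 ^ (j : ℕ)

/-- The quadratic covariant `Q_n = (F, F)_{2n}`. -/
noncomputable def quadCovariant (n : ℕ) : MvPolynomial (Fin 2) (CoeffRing n) :=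
  transvectant (2 * n) (genericForm n) (genericForm n)

/-- The discriminant `b² - 4ac` of a binary quadratic form `a x² + b x z + c z²`. -/
noncomputable def quadDisc {R : Type*} [CommRing R] (Q : MvPolynomial (Fin 2) R) : R :=
  coeff (Finsupp.single 0 1 + Finsupp.single 1 1) Q ^ 2
    - 4 * coeff (Finsupp.single 0 2) Q * coeff (Finsupp.single 1 2) Q

/-- `Δ_n = B_n² - 4 A_n C_n`, where `Q_n = A_n x² + B_n x z + C_n z²`. -/
noncomputable def Delta (n : ℕ) : CoeffRing n := quadDisc (quadCovariant n)

/-- The content of an integer polynomial: the nonnegative gcd of all its coefficients. -/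
noncomputable def content {σ : Type*} (P : MvPolynomial σ ℤ) : ℕ :=
  P.support.gcd fun d => (coeff d P).natAbs

/-- `S(n)`, the content of `Δ_n`. -/
noncomputable def S (n : ℕ) : ℕ := content (Delta n)

/-- The squarefree part of a positive integer: the product of the primes dividing it to an odd
power. -/
def sqf (m : ℕ) : ℕ := ∏ p ∈ m.primeFactors with Odd (padicValNat p m), p

/-- `sqf m` is the squarefree `d` for which `m / d` is a square. -/
theorem sqf_spec {m : ℕ} (hm : m ≠ 0) : Squarefree (sqf m) ∧ ∃ b : ℕ, m = sqf m * b ^ 2 := by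
  constructor
  · unfold sqf
    refine Finset.squarefree_prod_of_pairwise_isCoprime ?_ ?_
    · intro p hp q hq hpq
      rw [Finset.mem_coe, Finset.mem_filter, Nat.mem_primeFactors] at hp hq
      exact Nat.coprime_iff_isRelPrime.1 ((Nat.coprime_primes hp.1.1 hq.1.1).2 hpq)
    · intro p hp
      exact (Nat.prime_of_mem_primeFactors (Finset.mem_filter.1 hp).1).prime.squarefree
  · refine ⟨∏ p ∈ m.primeFactors, p ^ (padicValNat p m / 2), ?_⟩
    unfold sqf
    rw [Finset.prod_filter, ← Finset.prod_pow, ← Finset.prod_mul_distrib]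
    conv_lhs => rw [← Nat.prod_factorization_pow_eq_self hm, Finsupp.prod, Nat.support_factorization]
    refine Finset.prod_congr rfl fun p hp => ?_
    rw [Nat.factorization_def m (Nat.prime_of_mem_primeFactors hp), ← pow_mul]
    split_ifs with h
    · rw [← pow_succ']
      congr 1
      obtain ⟨c, hc⟩ := h
      omega
    · rw [one_mul]
      congr 1
      obtain ⟨c, hc⟩ := Nat.not_odd_iff_even.1 h
      omega

/-- `a(m) = p` if `m = p^k` with `p` an odd prime and `k ≥ 1`, and `a(m) = 1` otherwise; the prime
`p` is the least prime factor of `p^k`. -/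
noncomputable def a (m : ℕ) : ℕ :=
  open Classical in
  if ∃ p k : ℕ, p.Prime ∧ p ≠ 2 ∧ 1 ≤ k ∧ m = p ^ k then m.minFac else 1

theorem a_prime_pow {p k : ℕ} (hp : p.Prime) (hp2 : p ≠ 2) (hk : 1 ≤ k) : a (p ^ k) = p := by
  unfold a
  rw [if_pos ⟨p, k, hp, hp2, hk, rfl⟩, hp.pow_minFac (by omega)]

end QuarticInvariant

/-! Carrying out the derivatives gives `Delta n` = (2(2n)!)² · `reducedDisc`, and `reducedDisc` is
M² - O·O', where M, O, O' are alternating sums of products f_i f_k with weights `beta n j` (in M)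
and `gamma n j` (in O and O'). The square factor does not affect parity, so for each prime p only
the exact power p^m dividing `reducedDisc` identically matters. `padicValNat_S` reads m off from a
divisibility and one integer specialization attaining it.

Let e be the least p-adic valuation among all the weights. Clearly p^(2e) divides `reducedDisc`.
Testing on forms with at most four nonzero coefficients shows that this is sharp
(`exists_not_dvd_of_minimal`) unless e is attained only by the two central weights, `beta n 0` and
`gamma n 0`. These can cancel, because `gamma n 0` = (n+1) `beta n 0` and so β₀² - γ₀² = -β₀²
n(n+2).

The ratio of consecutive `alpha n j` is (n+2+j)/(n+1-j). If p^k exactly divides n+2, it telescopes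
to v(α_j) = v(α_0) + k - v(j) for 1 ≤ j < p^k with j ≤ n+1. If n+2 ≠ p^k, then j = p^k is still an
admissible index and its valuation drops back to at most v(α_0), so the exceptional case cannot
occur. If n+2 = p^k, every noncentral weight has valuation above e. For odd p the cross terms γ_0
γ_j then give exactly 2e+1, which is odd. For p = 2 the factor 2 in γ_j and in the cross terms of M²
raises this to 2e+2, attained by a β_j², which is even. -/

namespace QuarticInvariant

open MvPolynomial

/-! ### Derivatives of binary forms and coefficients of quadratic forms. -/

section Derivatives

variable {R : Type*} [CommRing R]

theorem iterate_pderiv_sum {σ ι : Type*} (s : Finset ι) (k : σ) (b : ℕ)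
    (G : ι → MvPolynomial σ R) :
    (⇑(pderiv (R := R) k))^[b] (∑ j ∈ s, G j) = ∑ j ∈ s, (⇑(pderiv (R := R) k))^[b] (G j) := by
  induction b with
  | zero => rfl
  | succ b ih => simp only [Function.iterate_succ_apply', ih, map_sum]

theorem partialXZ_sum {ι : Type*} (s : Finset ι) (a b : ℕ) (G : ι → MvPolynomial (Fin 2) R) :
    partialXZ a b (∑ j ∈ s, G j) = ∑ j ∈ s, partialXZ a b (G j) := by
  simp only [partialXZ, iterate_pderiv_sum]

theorem iterate_pderiv_zero_monomial (c : R) (u w b : ℕ) :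
    (⇑(pderiv (R := R) (0 : Fin 2)))^[b] (C c * X 0 ^ u * X 1 ^ w)
      = C (c * u.descFactorial b) * X 0 ^ (u - b) * X 1 ^ w := by
  induction b with
  | zero => simp
  | succ b ih =>
    rw [Function.iterate_succ_apply', ih]
    simp only [Derivation.leibniz, Derivation.leibniz_pow, pderiv_C, pderiv_X_self,
      pderiv_X_of_ne (show (1 : Fin 2) ≠ 0 by decide), smul_eq_mul, nsmul_eq_mul,
      Nat.descFactorial_succ, Nat.cast_mul, map_mul, map_natCast, Nat.sub_sub,
      Derivation.map_natCast]
    ring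

theorem iterate_pderiv_one_monomial (c : R) (u w b : ℕ) :
    (⇑(pderiv (R := R) (1 : Fin 2)))^[b] (C c * X 0 ^ u * X 1 ^ w)
      = C (c * w.descFactorial b) * X 0 ^ u * X 1 ^ (w - b) := by
  induction b with
  | zero => simp
  | succ b ih =>
    rw [Function.iterate_succ_apply', ih]
    simp only [Derivation.leibniz, Derivation.leibniz_pow, pderiv_C, pderiv_X_self,
      pderiv_X_of_ne (show (0 : Fin 2) ≠ 1 by decide), smul_eq_mul, nsmul_eq_mul,
      Nat.descFactorial_succ, Nat.cast_mul, map_mul, map_natCast, Nat.sub_sub,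
      Derivation.map_natCast]
    ring

theorem partialXZ_monomial (c : R) (u w a b : ℕ) :
    partialXZ a b (C c * X 0 ^ u * X 1 ^ w)
      = C (c * w.descFactorial b * u.descFactorial a) * X 0 ^ (u - a) * X 1 ^ (w - b) := by
  rw [partialXZ, iterate_pderiv_one_monomial, iterate_pderiv_zero_monomial]

/-- A derivative of order `a + b` of a form of degree `a + b + 1` is linear. -/
theorem partialXZ_form (f : ℕ → R) (a b : ℕ) :
    partialXZ a b (∑ j ∈ Finset.range (a + b + 2), C (f j) * X 0 ^ (a + b + 1 - j) * X 1 ^ j)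
      = C (((b.factorial * (a + 1).factorial : ℕ) : R) * f b) * X 0
        + C ((((b + 1).factorial * a.factorial : ℕ) : R) * f (b + 1)) * X 1 := by
  rw [partialXZ_sum]
  simp only [partialXZ_monomial]
  rw [Finset.sum_eq_add_of_mem b (b + 1) (by simp; omega) (by simp) (by omega)]
  · rw [show a + b + 1 - b = a + 1 by omega, show a + b + 1 - (b + 1) = a by omega]
    have h1 : (a + 1).descFactorial a = (a + 1).factorial := by
      have := Nat.factorial_mul_descFactorial (show a ≤ a + 1 by omega)
      simpa using this
    have h2 : (b + 1).descFactorial b = (b + 1).factorial := by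
      have := Nat.factorial_mul_descFactorial (show b ≤ b + 1 by omega)
      simpa using this
    simp only [h1, h2, Nat.descFactorial_self, Nat.add_sub_cancel_left, Nat.sub_self,
      pow_zero, pow_one, mul_one, Nat.cast_mul, map_mul]
    ring
  -- For j < b the z-derivatives kill the monomial, and for j > b+1 the x-derivatives do, so
  -- truncated exponents never contribute.
  · intro j hj hne
    rw [Finset.mem_range] at hj
    rcases lt_or_ge j b with h | h
    · rw [Nat.descFactorial_of_lt h]; simp
    · rw [Nat.descFactorial_of_lt (show a + b + 1 - j < a by omega)]; simp

theorem coeff_quadratic (u v w : R) :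
    coeff (Finsupp.single 0 2)
        (C u * X 0 ^ 2 + C v * (X 0 * X 1) + C w * X 1 ^ 2 : MvPolynomial (Fin 2) R) = u ∧
    coeff (Finsupp.single 0 1 + Finsupp.single 1 1)
        (C u * X 0 ^ 2 + C v * (X 0 * X 1) + C w * X 1 ^ 2 : MvPolynomial (Fin 2) R) = v ∧
    coeff (Finsupp.single 1 2)
        (C u * X 0 ^ 2 + C v * (X 0 * X 1) + C w * X 1 ^ 2 : MvPolynomial (Fin 2) R) = w := by
  have hX : (X 0 * X 1 : MvPolynomial (Fin 2) R)
      = monomial (Finsupp.single 0 1 + Finsupp.single 1 1) 1 := by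
    simp [X, monomial_mul]
  have h1 : (Finsupp.single 0 2 : Fin 2 →₀ ℕ) ≠ Finsupp.single 0 1 + Finsupp.single 1 1 := by
    intro h; simpa using DFunLike.congr_fun h 1
  have h2 : (Finsupp.single 1 2 : Fin 2 →₀ ℕ) ≠ Finsupp.single 0 1 + Finsupp.single 1 1 := by
    intro h; simpa using DFunLike.congr_fun h 0
  have h3 : (Finsupp.single 1 2 : Fin 2 →₀ ℕ) ≠ Finsupp.single 0 2 := by
    intro h; simpa using DFunLike.congr_fun h 0
  simp only [coeff_add, coeff_C_mul, X_pow_eq_monomial, hX, coeff_monomial]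
  simp [h1, h2, h3, h1.symm, h2.symm, h3.symm]

theorem quadDisc_quadratic (u v w : R) :
    quadDisc (C u * X 0 ^ 2 + C v * (X 0 * X 1) + C w * X 1 ^ 2 : MvPolynomial (Fin 2) R)
      = v ^ 2 - 4 * u * w := by
  obtain ⟨h1, h2, h3⟩ := coeff_quadratic u v w
  rw [quadDisc, h1, h2, h3]

end Derivatives

/-! ### The quadratic covariant of the generic form. -/

/-- The coefficients of the generic form, extended by zero to all indices. -/
noncomputable def genericCoeff (n j : ℕ) : CoeffRing n :=
  if h : j < 2 * n + 2 then X ⟨j, h⟩ else 0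

theorem genericForm_eq (n : ℕ) :
    genericForm n = ∑ j ∈ Finset.range (2 * n + 2),
      C (genericCoeff n j) * X 0 ^ (2 * n + 1 - j) * X 1 ^ j := by
  rw [genericForm, ← Fin.sum_univ_eq_sum_range
    (fun j => C (genericCoeff n j) * X 0 ^ (2 * n + 1 - j) * X 1 ^ j)]
  refine Finset.sum_congr rfl fun j _ => ?_
  simp [genericCoeff]

/-- The coefficients `j! (2n+1-j)! f_j`. -/
def scaled {R : Type*} [CommRing R] (n : ℕ) (f : ℕ → R) (j : ℕ) : R :=
  ((j.factorial * (2 * n + 1 - j).factorial : ℕ) : R) * f j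

theorem partialXZ_genericForm {n i : ℕ} (hi : i ≤ 2 * n) :
    partialXZ (2 * n - i) i (genericForm n)
      = C (scaled n (genericCoeff n) i) * X 0 + C (scaled n (genericCoeff n) (i + 1)) * X 1 := by
  have h := partialXZ_form (genericCoeff n) (2 * n - i) i
  rw [Nat.sub_add_cancel hi] at h
  rw [genericForm_eq, h, scaled, scaled, show 2 * n + 1 - i = 2 * n - i + 1 by omega,
    show 2 * n + 1 - (i + 1) = 2 * n - i by omega]

theorem quadCovariant_eq (n : ℕ) (g : ℕ → CoeffRing n)
    (hg : g = scaled n (genericCoeff n)) :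
    quadCovariant n
      = C (∑ i ∈ Finset.range (2 * n + 1),
            (-1) ^ i * ((2 * n).choose i : CoeffRing n) * (g i * g (2 * n - i))) * X 0 ^ 2
        + C (∑ i ∈ Finset.range (2 * n + 1), (-1) ^ i * ((2 * n).choose i : CoeffRing n)
            * (g i * g (2 * n + 1 - i) + g (i + 1) * g (2 * n - i))) * (X 0 * X 1)
        + C (∑ i ∈ Finset.range (2 * n + 1),
            (-1) ^ i * ((2 * n).choose i : CoeffRing n) * (g (i + 1) * g (2 * n + 1 - i)))
          * X 1 ^ 2 := by
  rw [quadCovariant, transvectant]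
  simp only [map_sum, Finset.sum_mul, ← Finset.sum_add_distrib]
  refine Finset.sum_congr rfl fun i hi => ?_
  have hi' : i ≤ 2 * n := by simpa [Nat.lt_succ_iff] using hi
  have h2 := partialXZ_genericForm (n := n) (i := 2 * n - i) (by omega)
  rw [show 2 * n - (2 * n - i) = i by omega, show 2 * n - i + 1 = 2 * n + 1 - i by omega] at h2
  rw [partialXZ_genericForm hi', h2, ← hg]
  simp only [map_mul, map_add, map_pow, map_neg, map_one, map_natCast]
  ring

/-! ### Folding the covariant's coefficients into weighted sums. -/

/-- The weights `(n+1-j)! (n+1+j)!` of the products `f_{n-j} f_{n+j}`, before folding. -/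
def alpha (n j : ℕ) : ℕ := (n + 1 - j).factorial * (n + 1 + j).factorial

/-- The weights of the products `f_{n-j} f_{n+1+j}` in the middle coefficient. -/
def beta (n j : ℕ) : ℕ := (n - j).factorial * (n + 1 + j).factorial * (2 * j + 1)

/-- The weights of the products `f_{n-j} f_{n+j}` in the outer coefficients. -/
def gamma (n j : ℕ) : ℕ := if j = 0 then alpha n 0 else 2 * alpha n j

section Reduced

variable {R : Type*} [CommRing R]

/-- The outer coefficients of the reduced covariant, centred at the index `m`. -/
def outerCoeff (n m : ℕ) (f : ℕ → R) : R :=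
  ∑ j ∈ Finset.range (n + 1), (-1) ^ j * (gamma n j : R) * (f (m - j) * f (m + j))

/-- Half the middle coefficient of the reduced covariant. -/
def middleCoeff (n : ℕ) (f : ℕ → R) : R :=
  ∑ j ∈ Finset.range (n + 1), (-1) ^ j * (beta n j : R) * (f (n - j) * f (n + 1 + j))

/-- The discriminant `Δ_n` divided by `(2 (2n)!)²`, as a function of the coefficients. -/
def reducedDisc (n : ℕ) (f : ℕ → R) : R :=
  middleCoeff n f ^ 2 - outerCoeff n n f * outerCoeff n (n + 1) f

theorem sum_range_fold_odd {M : Type*} [AddCommMonoid M] (n : ℕ) (h : ℕ → M) :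
    ∑ i ∈ Finset.range (2 * n + 1), h i
      = h n + ∑ j ∈ Finset.range n, (h (n - (j + 1)) + h (n + (j + 1))) := by
  rw [show 2 * n + 1 = n + (n + 1) by omega, Finset.sum_range_add, Finset.sum_range_succ',
    ← Finset.sum_range_reflect, Finset.sum_add_distrib, Nat.add_zero]
  rw [add_comm (∑ j ∈ Finset.range n, h (n + (j + 1))), add_left_comm]
  congr 3
  funext j
  rw [Nat.sub_sub, add_comm 1]

theorem sum_range_fold_even {M : Type*} [AddCommMonoid M] (n : ℕ) (h : ℕ → M) :
    ∑ i ∈ Finset.range (2 * n + 2), h i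
      = ∑ j ∈ Finset.range (n + 1), (h (n - j) + h (n + 1 + j)) := by
  rw [show 2 * n + 2 = n + 1 + (n + 1) by omega, Finset.sum_range_add,
    ← Finset.sum_range_reflect, Finset.sum_add_distrib]
  rfl

theorem neg_one_pow_sub {n j : ℕ} (h : j ≤ n) : (-1 : R) ^ (n - j) = (-1) ^ n * (-1) ^ j := by
  obtain ⟨m, rfl⟩ := Nat.exists_eq_add_of_le h
  rw [Nat.add_sub_cancel_left, pow_add, mul_right_comm, ← pow_add, Even.neg_one_pow ⟨j, rfl⟩,
    one_mul]

theorem choose_mul_factorials_outer {n i k : ℕ} (h : i + k = 2 * n) :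
    (2 * n).choose i * (i.factorial * (k + 1).factorial * (k.factorial * (i + 1).factorial))
      = (2 * n).factorial * ((i + 1).factorial * (k + 1).factorial) := by
  have := Nat.choose_mul_factorial_mul_factorial (show i ≤ 2 * n by omega)
  rw [show 2 * n - i = k by omega] at this
  rw [← this]; ring

theorem sum_outer (n : ℕ) (f : ℕ → R) :
    ∑ i ∈ Finset.range (2 * n + 1), (-1) ^ i * ((2 * n).choose i : R)
        * (scaled n f i * scaled n f (2 * n - i))
      = (-1) ^ n * ((2 * n).factorial : R) * outerCoeff n n f := by
  have key : ∀ i k : ℕ, i + k = 2 * n →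
      (-1) ^ i * ((2 * n).choose i : R) * (scaled n f i * scaled n f k)
        = (-1) ^ i * ((2 * n).factorial : R)
          * (((i + 1).factorial * (k + 1).factorial : ℕ) : R) * (f i * f k) := by
    intro i k h
    have e := congrArg (Nat.cast (R := R)) (choose_mul_factorials_outer h)
    rw [Nat.cast_mul, Nat.cast_mul (2 * n).factorial] at e
    rw [scaled, scaled, show 2 * n + 1 - i = k + 1 by omega, show 2 * n + 1 - k = i + 1 by omega,
      mul_assoc ((-1) ^ i) ((2 * n).factorial : R), ← e]
    push_cast
    ring
  rw [sum_range_fold_odd, outerCoeff, Finset.sum_range_succ', add_comm, mul_add, Finset.mul_sum]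
  congr 1
  · refine Finset.sum_congr rfl fun j hj => ?_
    rw [Finset.mem_range] at hj
    rw [show 2 * n - (n - (j + 1)) = n + (j + 1) by omega,
      show 2 * n - (n + (j + 1)) = n - (j + 1) by omega, key _ _ (by omega), key _ _ (by omega),
      neg_one_pow_sub (by omega), pow_add (-1 : R) n, gamma, if_neg (by omega), alpha,
      show n - (j + 1) + 1 = n + 1 - (j + 1) by omega,
      show n + (j + 1) + 1 = n + 1 + (j + 1) by omega]
    push_cast
    ring
  · rw [show 2 * n - n = n by omega, key n n (by omega), gamma, if_pos rfl, alpha]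
    simp only [Nat.sub_zero, Nat.add_zero, pow_zero]
    ring

theorem sum_outer_shift (n : ℕ) (f : ℕ → R) :
    ∑ i ∈ Finset.range (2 * n + 1), (-1) ^ i * ((2 * n).choose i : R)
        * (scaled n f (i + 1) * scaled n f (2 * n + 1 - i))
      = (-1) ^ n * ((2 * n).factorial : R) * outerCoeff n (n + 1) f := by
  have key : ∀ i k : ℕ, i + k = 2 * n →
      (-1) ^ i * ((2 * n).choose i : R) * (scaled n f (i + 1) * scaled n f (k + 1))
        = (-1) ^ i * ((2 * n).factorial : R)
          * (((i + 1).factorial * (k + 1).factorial : ℕ) : R) * (f (i + 1) * f (k + 1)) := by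
    intro i k h
    have e := congrArg (Nat.cast (R := R)) (choose_mul_factorials_outer h)
    rw [Nat.cast_mul, Nat.cast_mul (2 * n).factorial] at e
    rw [scaled, scaled, show 2 * n + 1 - (i + 1) = k by omega,
      show 2 * n + 1 - (k + 1) = i by omega,
      mul_assoc ((-1) ^ i) ((2 * n).factorial : R), ← e]
    push_cast
    ring
  rw [sum_range_fold_odd, outerCoeff, Finset.sum_range_succ', add_comm, mul_add, Finset.mul_sum]
  congr 1
  · refine Finset.sum_congr rfl fun j hj => ?_
    rw [Finset.mem_range] at hj
    rw [show 2 * n + 1 - (n - (j + 1)) = n + (j + 1) + 1 by omega,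
      show 2 * n + 1 - (n + (j + 1)) = n - (j + 1) + 1 by omega, key _ _ (by omega),
      key _ _ (by omega),
      neg_one_pow_sub (by omega), pow_add (-1 : R) n, gamma, if_neg (by omega), alpha,
      show n - (j + 1) + 1 = n + 1 - (j + 1) by omega,
      show n + (j + 1) + 1 = n + 1 + (j + 1) by omega]
    push_cast
    ring
  · rw [show 2 * n + 1 - n = n + 1 by omega, key n n (by omega), gamma, if_pos rfl, alpha]
    simp only [Nat.sub_zero, Nat.add_zero, pow_zero]
    ring

theorem choose_mul_factorials_middle {n i k : ℕ} (h : i + k = 2 * n + 1) :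
    (2 * n).choose i * (i.factorial * k.factorial) = (2 * n).factorial * k := by
  rcases Nat.eq_zero_or_pos k with rfl | hk
  · rw [Nat.choose_eq_zero_of_lt (by omega)]; simp
  · obtain ⟨k, rfl⟩ := Nat.exists_eq_succ_of_ne_zero hk.ne'
    have := Nat.choose_mul_factorial_mul_factorial (show i ≤ 2 * n by omega)
    rw [show 2 * n - i = k by omega] at this
    rw [← this, Nat.succ_eq_add_one, Nat.factorial_succ]; ring

theorem sum_middle (n : ℕ) (f : ℕ → R) :
    ∑ i ∈ Finset.range (2 * n + 1), (-1) ^ i * ((2 * n).choose i : R)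
        * (scaled n f i * scaled n f (2 * n + 1 - i) + scaled n f (i + 1) * scaled n f (2 * n - i))
      = 2 * ((-1) ^ n * ((2 * n).factorial : R) * middleCoeff n f) := by
  have key : ∀ i k : ℕ, i + k = 2 * n + 1 →
      (-1) ^ i * ((2 * n).choose i : R) * (scaled n f i * scaled n f k)
        = (-1) ^ i * ((2 * n).factorial : R) * k
          * ((i.factorial * k.factorial : ℕ) : R) * (f i * f k) := by
    intro i k h
    have e := congrArg (Nat.cast (R := R)) (choose_mul_factorials_middle h)
    rw [Nat.cast_mul, Nat.cast_mul (2 * n).factorial] at e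
    rw [scaled, scaled, show 2 * n + 1 - i = k by omega, show 2 * n + 1 - k = i by omega,
      mul_assoc ((-1) ^ i) ((2 * n).factorial : R), ← e]
    push_cast
    ring
  -- The two halves of the middle coefficient are exchanged by i ↦ 2n - i; this is the source of the
  -- factor 2.
  have hrefl : ∑ i ∈ Finset.range (2 * n + 1), (-1) ^ i * ((2 * n).choose i : R)
        * (scaled n f (i + 1) * scaled n f (2 * n - i))
      = ∑ i ∈ Finset.range (2 * n + 1), (-1) ^ i * ((2 * n).choose i : R)
        * (scaled n f i * scaled n f (2 * n + 1 - i)) := by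
    rw [← Finset.sum_range_reflect]
    refine Finset.sum_congr rfl fun i hi => ?_
    have hi' : i ≤ 2 * n := by simpa [Nat.lt_succ_iff] using hi
    rw [show 2 * n + 1 - 1 - i = 2 * n - i by omega, show 2 * n - (2 * n - i) = i by omega,
      show 2 * n - i + 1 = 2 * n + 1 - i by omega, neg_one_pow_sub hi', Nat.choose_symm hi',
      Even.neg_one_pow (by simp)]
    ring
  simp only [mul_add, Finset.sum_add_distrib]
  rw [hrefl, ← two_mul]
  congr 1
  -- The added term has binomial coefficient zero; it makes the range symmetric under i ↦ 2n+1-i.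
  have hlast : ∑ i ∈ Finset.range (2 * n + 1), (-1) ^ i * ((2 * n).choose i : R)
        * (scaled n f i * scaled n f (2 * n + 1 - i))
      = ∑ i ∈ Finset.range (2 * n + 2), (-1) ^ i * ((2 * n).choose i : R)
        * (scaled n f i * scaled n f (2 * n + 1 - i)) := by
    rw [Finset.sum_range_succ _ (2 * n + 1), Nat.choose_eq_zero_of_lt (by omega)]
    simp
  rw [hlast, sum_range_fold_even, middleCoeff, Finset.mul_sum]
  refine Finset.sum_congr rfl fun j hj => ?_
  obtain ⟨m, hm⟩ := Nat.exists_eq_add_of_le (Nat.lt_succ_iff.1 (Finset.mem_range.1 hj))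
  -- The two paired terms have opposite signs and factors n+1+j and n-j, whose difference is the
  -- 2j+1 in `beta`.
  rw [show 2 * n + 1 - (n - j) = n + 1 + j by omega, show 2 * n + 1 - (n + 1 + j) = n - j by omega,
    key _ _ (by omega), key _ _ (by omega), neg_one_pow_sub (by omega), pow_add, pow_succ, beta,
    show n - j = m by omega, show n + 1 + j = m + (2 * j + 1) by omega]
  push_cast
  ring

end Reduced

/-! ### From the content to the reduced discriminant. -/

theorem Delta_eq (n : ℕ) :
    Delta n = C (((2 * (2 * n).factorial) ^ 2 : ℕ) : ℤ) * reducedDisc n (genericCoeff n) := by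
  rw [Delta, quadCovariant_eq n _ rfl, quadDisc_quadratic, sum_outer, sum_middle, sum_outer_shift,
    reducedDisc]
  have h : ((-1 : CoeffRing n) ^ n) ^ 2 = 1 := by
    rw [← pow_mul]; exact Even.neg_one_pow ⟨n, by ring⟩
  push_cast
  simp only [map_pow, map_mul, map_natCast, map_ofNat]
  linear_combination (4 * ((2 * n).factorial : CoeffRing n) ^ 2 *
    (middleCoeff n (genericCoeff n) ^ 2
      - outerCoeff n n (genericCoeff n) * outerCoeff n (n + 1) (genericCoeff n))) * h

theorem C_dvd_iff_dvd_content {σ : Type*} (P : MvPolynomial σ ℤ) (d : ℕ) :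
    C (d : ℤ) ∣ P ↔ d ∣ content P := by
  rw [C_dvd_iff_dvd_coeff, content, Finset.dvd_gcd_iff]
  refine ⟨fun h m _ => Int.natCast_dvd.1 (h m), fun h m => ?_⟩
  by_cases hm : m ∈ P.support
  · exact Int.natCast_dvd.2 (h m hm)
  · rw [notMem_support_iff.1 hm]; exact dvd_zero _

theorem map_reducedDisc {R R' : Type*} [CommRing R] [CommRing R'] (φ : R →+* R') (n : ℕ)
    (f : ℕ → R) : φ (reducedDisc n f) = reducedDisc n fun j => φ (f j) := by
  simp [reducedDisc, middleCoeff, outerCoeff]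

theorem reducedDisc_congr {R : Type*} [CommRing R] {n : ℕ} {f g : ℕ → R}
    (h : ∀ j < 2 * n + 2, f j = g j) : reducedDisc n f = reducedDisc n g := by
  have h1 : middleCoeff n f = middleCoeff n g := by
    refine Finset.sum_congr rfl fun j hj => ?_
    rw [Finset.mem_range] at hj
    rw [h _ (by omega), h _ (by omega)]
  have h2 : outerCoeff n n f = outerCoeff n n g := by
    refine Finset.sum_congr rfl fun j hj => ?_
    rw [Finset.mem_range] at hj
    rw [h _ (by omega), h _ (by omega)]
  have h3 : outerCoeff n (n + 1) f = outerCoeff n (n + 1) g := by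
    refine Finset.sum_congr rfl fun j hj => ?_
    rw [Finset.mem_range] at hj
    rw [h _ (by omega), h _ (by omega)]
  rw [reducedDisc, reducedDisc, h1, h2, h3]

theorem eval_Delta (n : ℕ) (f : ℕ → ℤ) :
    eval (fun j : Fin (2 * n + 2) => f j) (Delta n)
      = ((2 * (2 * n).factorial) ^ 2 : ℕ) * reducedDisc n f := by
  rw [Delta_eq, map_mul, eval_C, map_reducedDisc]
  congr 1
  refine reducedDisc_congr fun j hj => ?_
  simp [genericCoeff, hj]

/-- The valuation of the content is determined by a power of `p` dividing the reduced discriminant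
identically, and a specialization of exactly this valuation. -/
theorem padicValNat_S {p : ℕ} [hp : Fact p.Prime] {n m : ℕ}
    (hdvd : ((p ^ m : ℕ) : CoeffRing n) ∣ reducedDisc n (genericCoeff n))
    (hex : ∃ f : ℕ → ℤ, ¬ ((p ^ (m + 1) : ℕ) : ℤ) ∣ reducedDisc n f) :
    S n ≠ 0 ∧ padicValNat p (S n) = 2 * padicValNat p (2 * (2 * n).factorial) + m := by
  obtain ⟨f, hf⟩ := hex
  have hK : 2 * (2 * n).factorial ≠ 0 := by positivity
  obtain ⟨r, hr⟩ := pow_padicValNat_dvd (p := p) (n := 2 * (2 * n).factorial)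
  have hnr : ¬ p ∣ r := by
    rintro ⟨t, rfl⟩
    refine pow_succ_padicValNat_not_dvd (p := p) hK ⟨t, ?_⟩
    rw [pow_succ, mul_assoc]
    exact hr
  set s := padicValNat p (2 * (2 * n).factorial)
  have hSdvd : ∀ d : ℕ, d ∣ S n →
      (d : ℤ) ∣ ((2 * (2 * n).factorial) ^ 2 : ℕ) * reducedDisc n f := by
    intro d hd
    obtain ⟨Q, hQ⟩ := (C_dvd_iff_dvd_content (Delta n) d).2 hd
    rw [← eval_Delta, hQ, map_mul, eval_C]
    exact dvd_mul_right _ _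
  have hlow : p ^ (2 * s + m) ∣ S n := by
    obtain ⟨t, ht⟩ := hdvd
    refine (C_dvd_iff_dvd_content (Delta n) _).1 ⟨C ((r : ℤ) ^ 2) * t, ?_⟩
    rw [Delta_eq, ht, hr]
    push_cast
    simp only [map_pow, map_mul, map_natCast]
    ring
  -- The content divides every integer value of `Delta n`, so the specialization `f` bounds its
  -- valuation from above.
  have hhigh : ¬ p ^ (2 * s + m + 1) ∣ S n := by
    intro h
    have h := hSdvd _ h
    rw [hr, mul_pow, ← pow_mul, mul_comm s 2, add_assoc, pow_add, Nat.cast_mul, Nat.cast_mul,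
      mul_assoc] at h
    have h := Int.dvd_of_mul_dvd_mul_left (by exact_mod_cast (pow_pos hp.out.pos _).ne') h
    refine hf (IsCoprime.dvd_of_dvd_mul_left ?_ h)
    rw [Nat.isCoprime_iff_coprime]
    exact Nat.Coprime.pow _ _ ((Nat.Prime.coprime_iff_not_dvd hp.out).2 hnr)
  have hS : S n ≠ 0 := fun h => hhigh (h ▸ dvd_zero _)
  refine ⟨hS, le_antisymm ?_ ((padicValNat_dvd_iff_le hS).1 hlow)⟩
  by_contra! hlt
  exact hhigh ((padicValNat_dvd_iff_le hS).2 hlt)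

/-! ### Lower bounds: powers dividing the reduced discriminant. -/

section Divisibility

variable {R : Type*} [CommRing R]

theorem natCast_dvd_sum_range_succ_sub {n u : ℕ} {c : ℕ → ℕ} (h : ∀ j, 1 ≤ j → j ≤ n → u ∣ c j)
    (f : ℕ → R) :
    ∃ t : R, ∑ j ∈ Finset.range (n + 1), (-1) ^ j * (c j : R) * f j = c 0 * f 0 + u * t := by
  rw [Finset.sum_range_succ']
  have : (u : R) ∣ ∑ j ∈ Finset.range n, (-1) ^ (j + 1) * (c (j + 1) : R) * f (j + 1) := by
    refine Finset.dvd_sum fun j hj => ?_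
    rw [Finset.mem_range] at hj
    exact ((Nat.cast_dvd_cast (h (j + 1) (by omega) (by omega))).mul_left _).mul_right _
  obtain ⟨t, ht⟩ := this
  exact ⟨t, by rw [ht]; ring⟩

/-- If `u` divides the noncentral weights `beta`, and `w` the noncentral weights `gamma`, then the
reduced discriminant is divisible by whatever divides the expansion coefficients. -/
theorem natCast_dvd_reducedDisc {n u w M : ℕ} (hu : ∀ j, 1 ≤ j → j ≤ n → u ∣ beta n j)
    (hw : ∀ j, 1 ≤ j → j ≤ n → w ∣ gamma n j)
    (h0 : (M : ℤ) ∣ (beta n 0 : ℤ) ^ 2 - (gamma n 0 : ℤ) ^ 2) (h1 : M ∣ 2 * beta n 0 * u)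
    (h2 : M ∣ u ^ 2) (h3 : M ∣ gamma n 0 * w) (h4 : M ∣ w ^ 2) (f : ℕ → R) :
    (M : R) ∣ reducedDisc n f := by
  obtain ⟨b, hb⟩ := natCast_dvd_sum_range_succ_sub hu fun j => f (n - j) * f (n + 1 + j)
  obtain ⟨x, hx⟩ := natCast_dvd_sum_range_succ_sub hw fun j => f (n - j) * f (n + j)
  obtain ⟨y, hy⟩ := natCast_dvd_sum_range_succ_sub hw fun j => f (n + 1 - j) * f (n + 1 + j)
  have e0 : (M : R) ∣ (beta n 0 : R) ^ 2 - (gamma n 0 : R) ^ 2 := by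
    have := map_dvd (Int.castRingHom R) h0
    simpa using this
  have e1 : (M : R) ∣ 2 * beta n 0 * u := by exact_mod_cast Nat.cast_dvd_cast (α := R) h1
  have e2 : (M : R) ∣ (u : R) ^ 2 := by exact_mod_cast Nat.cast_dvd_cast (α := R) h2
  have e3 : (M : R) ∣ (gamma n 0 : R) * w := by exact_mod_cast Nat.cast_dvd_cast (α := R) h3
  have e4 : (M : R) ∣ (w : R) ^ 2 := by exact_mod_cast Nat.cast_dvd_cast (α := R) h4
  -- The central weights are isolated because they alone can cancel. `u` and `w` are separate since
  -- at p = 2 the weights `gamma` carry one more factor 2.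
  have : reducedDisc n f
      = ((beta n 0 : R) ^ 2 - (gamma n 0 : R) ^ 2) * (f n * f (n + 1)) ^ 2
        + 2 * beta n 0 * u * (f n * f (n + 1) * b) + (u : R) ^ 2 * b ^ 2
        - (gamma n 0 : R) * w * (f n ^ 2 * y + f (n + 1) ^ 2 * x) - (w : R) ^ 2 * (x * y) := by
    rw [reducedDisc, middleCoeff, outerCoeff, outerCoeff, hb, hx, hy]
    simp only [Nat.sub_zero, Nat.add_zero]
    ring
  rw [this]
  exact ((((e0.mul_right _).add (e1.mul_right _)).add (e2.mul_right _)).sub (e3.mul_right _)).sub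
    (e4.mul_right _)

end Divisibility

/-! ### Upper bounds: values at sparse coefficient sequences. -/

section Specializations

open Finset

theorem reducedDisc_pair {n j : ℕ} (hj : 1 ≤ j) (hjn : j ≤ n) :
    ∃ f : ℕ → ℤ, reducedDisc n f = (beta n j : ℤ) ^ 2 := by
  refine ⟨fun i => if i = n - j ∨ i = n + 1 + j then 1 else 0, ?_⟩
  have hb : middleCoeff n (fun i => if i = n - j ∨ i = n + 1 + j then (1 : ℤ) else 0)
      = (-1) ^ j * beta n j := by
    rw [middleCoeff, sum_eq_single_of_mem j (by simp; omega)]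
    · simp
    · intro i hi hne
      rw [mem_range] at hi
      rw [if_neg (c := n - i = _ ∨ _) (by omega)]; simp
  have ha : outerCoeff n n (fun i => if i = n - j ∨ i = n + 1 + j then (1 : ℤ) else 0) = 0 := by
    refine sum_eq_zero fun i hi => ?_
    rw [mem_range] at hi
    beta_reduce
    by_cases h : i = j
    · rw [if_neg (c := n + i = _ ∨ _) (by omega)]; simp
    · rw [if_neg (c := n - i = _ ∨ _) (by omega)]; simp
  rw [reducedDisc, hb, ha, mul_pow, ← pow_mul, Even.neg_one_pow ⟨j, by ring⟩]
  ring

theorem reducedDisc_centre (n : ℕ) :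
    ∃ f : ℕ → ℤ, reducedDisc n f = (beta n 0 : ℤ) ^ 2 - (gamma n 0 : ℤ) ^ 2 := by
  refine ⟨fun i => if i = n ∨ i = n + 1 then 1 else 0, ?_⟩
  have hb : middleCoeff n (fun i => if i = n ∨ i = n + 1 then (1 : ℤ) else 0) = beta n 0 := by
    rw [middleCoeff, sum_eq_single_of_mem 0 (by simp)]
    · simp
    · intro i hi hne
      rw [mem_range] at hi
      rw [if_neg (c := n - i = _ ∨ _) (by omega)]; simp
  have ha : outerCoeff n n (fun i => if i = n ∨ i = n + 1 then (1 : ℤ) else 0) = gamma n 0 := by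
    rw [outerCoeff, sum_eq_single_of_mem 0 (by simp)]
    · simp
    · intro i hi hne
      rw [mem_range] at hi
      rw [if_neg (c := n - i = _ ∨ _) (by omega)]; simp
  have hc : outerCoeff n (n + 1) (fun i => if i = n ∨ i = n + 1 then (1 : ℤ) else 0)
      = gamma n 0 := by
    rw [outerCoeff, sum_eq_single_of_mem 0 (by simp)]
    · simp
    · intro i hi hne
      rw [mem_range] at hi
      rw [if_neg (c := n + 1 + i = _ ∨ _) (by omega)]; simp
  rw [reducedDisc, hb, ha, hc]
  ring

/-- This isolates `gamma n j` squared modulo `beta` terms. The single coefficient -1 gives the two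
outer coefficients opposite noncentral parts, so their product is a difference of squares. For j = 1
the support meets the centre, which adds the γ_0² term. -/
theorem reducedDisc_quadruple {n j : ℕ} (hj : 1 ≤ j) (hjn : j ≤ n) :
    ∃ f : ℕ → ℤ, reducedDisc n f = ((beta n j : ℤ) + beta n (j - 1)) ^ 2 + (gamma n j : ℤ) ^ 2
      - if j = 1 then (gamma n 0 : ℤ) ^ 2 else 0 := by
  set f : ℕ → ℤ := fun i => if i = n - j then -1 else
    if i = n + 1 - j ∨ i = n + j ∨ i = n + 1 + j then 1 else 0 with hf
  have f0 : ∀ i, i ≠ n - j → i ≠ n + 1 - j → i ≠ n + j → i ≠ n + 1 + j → f i = 0 := by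
    intro i h1 h2 h3 h4
    rw [hf]; simp only
    rw [if_neg h1, if_neg (by omega)]
  have f1 : f (n - j) = -1 := by simp [hf]
  have f2 : f (n + 1 - j) = 1 := by
    rw [hf]; simp only
    rw [if_neg (by omega), if_pos (by simp)]
  have f3 : f (n + j) = 1 := by
    rw [hf]; simp only
    rw [if_neg (by omega), if_pos (by simp)]
  have f4 : f (n + 1 + j) = 1 := by
    rw [hf]; simp only
    rw [if_neg (by omega), if_pos (by simp)]
  refine ⟨f, ?_⟩
  have hs : (-1 : ℤ) ^ j = - (-1) ^ (j - 1) := by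
    obtain ⟨i, rfl⟩ := Nat.exists_eq_add_of_le' hj
    rw [Nat.add_sub_cancel, pow_succ]; ring
  have hsq : ((-1 : ℤ) ^ (j - 1)) ^ 2 = 1 := by
    rw [← pow_mul]; exact Even.neg_one_pow ⟨j - 1, by ring⟩
  have hb : middleCoeff n f = (-1) ^ (j - 1) * (beta n j + beta n (j - 1)) := by
    rw [middleCoeff, sum_eq_add_of_mem j (j - 1) (by simp; omega) (by simp; omega) (by omega)]
    · rw [show n - (j - 1) = n + 1 - j by omega, show n + 1 + (j - 1) = n + j by omega,
        f1, f2, f3, f4, hs]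
      ring
    · intro i hi hne
      rw [mem_range] at hi
      rw [f0 (n - i) (by omega) (by omega) (by omega) (by omega)]; simp
  have ha : outerCoeff n n f
      = (-1) ^ (j - 1) * gamma n j + if j = 1 then (gamma n 0 : ℤ) else 0 := by
    rw [outerCoeff, sum_eq_add_of_mem j 0 (by simp; omega) (by simp) (by omega)]
    · rw [f1, f3, hs]
      congr 1
      · ring
      · simp only [Nat.sub_zero, Nat.add_zero, pow_zero, one_mul]
        split_ifs with h
        · subst h
          rw [Nat.add_sub_cancel] at f2
          rw [f2]; ring
        · rw [f0 n (by omega) (by omega) (by omega) (by omega)]; ring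
    · intro i hi hne
      rw [mem_range] at hi
      by_cases h : i = j - 1
      · rw [f0 (n + i) (by omega) (by omega) (by omega) (by omega)]; simp
      · rw [f0 (n - i) (by omega) (by omega) (by omega) (by omega)]; simp
  have hc : outerCoeff n (n + 1) f
      = - (-1) ^ (j - 1) * gamma n j + if j = 1 then (gamma n 0 : ℤ) else 0 := by
    rw [outerCoeff, sum_eq_add_of_mem j 0 (by simp; omega) (by simp) (by omega)]
    · rw [f2, f4, hs]
      congr 1
      · ring
      · simp only [Nat.sub_zero, Nat.add_zero, pow_zero, one_mul]
        split_ifs with h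
        · subst h
          rw [f3]; ring
        · rw [f0 (n + 1) (by omega) (by omega) (by omega) (by omega)]; ring
    · intro i hi hne
      rw [mem_range] at hi
      by_cases h : i = j - 1
      · rw [f0 (n + 1 - i) (by omega) (by omega) (by omega) (by omega)]; simp
      · rw [f0 (n + 1 + i) (by omega) (by omega) (by omega) (by omega)]; simp
  rw [reducedDisc, hb, ha, hc]
  split_ifs <;> linear_combination
    (((beta n j : ℤ) + beta n (j - 1)) ^ 2 + (gamma n j : ℤ) ^ 2) * hsq

/-- The support contains no pair of indices with sum 2n+1, so the middle coefficient vanishes and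
only a cross term of the outer ones survives. -/
theorem reducedDisc_triple {n j : ℕ} (hj : 1 ≤ j) (hjn : j ≤ n) :
    ∃ f : ℕ → ℤ, reducedDisc n f = - (-1) ^ j * ((gamma n 0 : ℤ) * gamma n j) := by
  set f : ℕ → ℤ := fun i => if i = n ∨ i = n + 1 - j ∨ i = n + 1 + j then 1 else 0 with hf
  have f0 : ∀ i, i ≠ n → i ≠ n + 1 - j → i ≠ n + 1 + j → f i = 0 := by
    intro i h1 h2 h3
    rw [hf]; simp only
    rw [if_neg (by omega)]
  have f1 : f n = 1 := by simp [hf]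
  have f2 : f (n + 1 - j) = 1 := by simp [hf]
  have f3 : f (n + 1 + j) = 1 := by simp [hf]
  refine ⟨f, ?_⟩
  have hb : middleCoeff n f = 0 := by
    refine sum_eq_zero fun i hi => ?_
    rw [mem_range] at hi
    by_cases h : i = j
    · rw [f0 (n - i) (by omega) (by omega) (by omega)]; simp
    · rw [f0 (n + 1 + i) (by omega) (by omega) (by omega)]; simp
  have ha : outerCoeff n n f = gamma n 0 := by
    rw [outerCoeff, sum_eq_single_of_mem 0 (by simp)]
    · simp [f1]
    · intro i hi hne
      rw [mem_range] at hi
      by_cases h : i = j + 1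
      · rw [f0 (n - i) (by omega) (by omega) (by omega)]; simp
      · rw [f0 (n + i) (by omega) (by omega) (by omega)]; simp
  have hc : outerCoeff n (n + 1) f = (-1) ^ j * gamma n j := by
    rw [outerCoeff, sum_eq_single_of_mem j (by simp; omega)]
    · rw [f2, f3]; ring
    · intro i hi hne
      rw [mem_range] at hi
      rw [f0 (n + 1 + i) (by omega) (by omega) (by omega)]; simp
  rw [reducedDisc, hb, ha, hc]
  ring

end Specializations

/-! ### Valuations of the weights. -/

theorem alpha_pos (n j : ℕ) : 0 < alpha n j := by unfold alpha; positivity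

theorem beta_pos (n j : ℕ) : 0 < beta n j := by unfold beta; positivity

theorem gamma_pos (n j : ℕ) : 0 < gamma n j := by
  unfold gamma
  have := alpha_pos n j
  have := alpha_pos n 0
  split_ifs <;> omega

theorem alpha_succ_mul {n j : ℕ} (h : j ≤ n) :
    alpha n (j + 1) * (n + 1 - j) = alpha n j * (n + 2 + j) := by
  obtain ⟨m, rfl⟩ := Nat.exists_eq_add_of_le h
  simp only [alpha, show j + m + 1 - (j + 1) = m by omega, show j + m + 1 - j = m + 1 by omega,
    show j + m + 1 + (j + 1) = j + m + 1 + j + 1 by omega, Nat.factorial_succ]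
  ring

theorem beta_mul {n j : ℕ} (h : j ≤ n) : beta n j * (n + 1 - j) = alpha n j * (2 * j + 1) := by
  obtain ⟨m, rfl⟩ := Nat.exists_eq_add_of_le h
  simp only [alpha, beta, show j + m + 1 - j = m + 1 by omega, show j + m - j = m by omega,
    Nat.factorial_succ m]
  ring

section Valuations

variable {p : ℕ} [hp : Fact p.Prime]

theorem padicValNat_eq_of_add_eq {x y q k : ℕ} (hy : y ≠ 0) (hx : x ≠ 0) (hq : p ^ k ∣ q)
    (h : x + y = q) (hk : padicValNat p y < k) : padicValNat p x = padicValNat p y := by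
  have hdvd : ∀ s ≤ k, (p ^ s ∣ x ↔ p ^ s ∣ y) := fun s hs => by
    have : p ^ s ∣ x + y := h ▸ (pow_dvd_pow p hs).trans hq
    exact ⟨(Nat.dvd_add_right · |>.1 this), (Nat.dvd_add_left · |>.1 this)⟩
  apply le_antisymm
  · by_contra! hlt
    have := (hdvd _ hk).1 ((padicValNat_dvd_iff_le hx).2 hlt)
    exact pow_succ_padicValNat_not_dvd hy this
  · exact (padicValNat_dvd_iff_le hx).1 ((hdvd _ hk.le).2 pow_padicValNat_dvd)

theorem padicValNat_add_of_lt {q y k : ℕ} (hy : y ≠ 0) (hq : p ^ k ∣ q)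
    (hk : padicValNat p y < k) : padicValNat p (q + y) = padicValNat p y := by
  have hdvd : ∀ s ≤ k, (p ^ s ∣ q + y ↔ p ^ s ∣ y) := fun s hs =>
    Nat.dvd_add_right ((pow_dvd_pow p hs).trans hq)
  apply le_antisymm
  · by_contra! hlt
    have := (hdvd _ hk).1 ((padicValNat_dvd_iff_le (by omega)).2 hlt)
    exact pow_succ_padicValNat_not_dvd hy this
  · exact (padicValNat_dvd_iff_le (by omega)).1 ((hdvd _ hk.le).2 pow_padicValNat_dvd)

theorem padicValNat_lt_of_lt_pow {y k : ℕ} (hy : y ≠ 0) (h : y < p ^ k) : padicValNat p y < k := by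
  by_contra! hk
  have := Nat.le_of_dvd (Nat.pos_of_ne_zero hy) ((padicValNat_dvd_iff_le hy).2 hk)
  omega

theorem padicValNat_alpha_succ {n j : ℕ} (h : j ≤ n) :
    padicValNat p (alpha n (j + 1)) + padicValNat p (n + 1 - j)
      = padicValNat p (alpha n j) + padicValNat p (n + 2 + j) := by
  rw [← padicValNat.mul (alpha_pos _ _).ne' (by omega), alpha_succ_mul h,
    padicValNat.mul (alpha_pos _ _).ne' (by omega)]

theorem padicValNat_beta {n j : ℕ} (h : j ≤ n) :
    padicValNat p (beta n j) + padicValNat p (n + 1 - j)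
      = padicValNat p (alpha n j) + padicValNat p (2 * j + 1) := by
  rw [← padicValNat.mul (beta_pos _ _).ne' (by omega), beta_mul h,
    padicValNat.mul (alpha_pos _ _).ne' (by omega)]

/-- In the recurrence of `alpha_succ_mul`, n+1-j has the valuation of j+1, and n+2+j that of j once
j ≥ 1, since n+2 is divisible by p^k and the indices stay below p^k. The product therefore
telescopes; the term k enters at j = 0. -/
theorem padicValNat_alpha {n k : ℕ} (hk : p ^ k ∣ n + 2) (hkv : padicValNat p (n + 2) = k) {j : ℕ}
    (hj : 1 ≤ j) (hjn : j ≤ n + 1) (hjk : j < p ^ k) :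
    padicValNat p (alpha n j) + padicValNat p j = padicValNat p (alpha n 0) + k := by
  induction j, hj using Nat.le_induction with
  | base =>
    have h := padicValNat_alpha_succ (p := p) (Nat.zero_le n)
    have h1 : padicValNat p (n + 1) = padicValNat p 1 :=
      padicValNat_eq_of_add_eq one_ne_zero (by omega) hk rfl (padicValNat_lt_of_lt_pow one_ne_zero hjk)
    simp only [Nat.sub_zero, Nat.add_zero, Nat.zero_add] at h
    rw [hkv] at h
    omega
  | succ j hj ih =>
    have h := padicValNat_alpha_succ (p := p) (show j ≤ n by omega)
    have h1 : padicValNat p (n + 1 - j) = padicValNat p (j + 1) :=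
      padicValNat_eq_of_add_eq (by omega) (by omega) hk (by omega)
        (padicValNat_lt_of_lt_pow (by omega) hjk)
    have h2 : padicValNat p (n + 2 + j) = padicValNat p j :=
      padicValNat_add_of_lt (by omega) hk (padicValNat_lt_of_lt_pow (by omega) (by omega))
    have := ih (by omega) (by omega)
    omega

/-- Unless `n + 2` is a power of `p`, some noncentral `alpha` has no larger valuation than the
central one. -/
theorem padicValNat_alpha_le {n k : ℕ} (hn : 1 ≤ n) (hk : p ^ k ∣ n + 2) (hkv : padicValNat p (n + 2) = k)
    (hne : n + 2 ≠ p ^ k) : 1 ≤ p ^ k ∧ p ^ k ≤ n ∧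
    padicValNat p (alpha n (p ^ k)) ≤ padicValNat p (alpha n 0) := by
  have hpos : 1 ≤ p ^ k := Nat.one_le_pow _ _ hp.out.pos
  have hle : p ^ k ≤ n := by
    obtain ⟨s, hs⟩ := hk
    have hs2 : 2 ≤ s := by
      rcases s with _ | _ | s
      · omega
      · simp at hs; omega
      · omega
    rcases Nat.lt_or_ge 1 (p ^ k) with h | h
    · nlinarith
    · omega
  refine ⟨hpos, hle, ?_⟩
  -- In the last step, to j = p^k, the divisor n+2-p^k is a multiple of p^k, which cancels the gain
  -- k.
  have h := padicValNat_alpha_succ (p := p) (show p ^ k - 1 ≤ n by omega)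
  rw [show p ^ k - 1 + 1 = p ^ k by omega] at h
  rcases Nat.lt_or_ge 1 (p ^ k) with h1 | h1
  · have ha := padicValNat_alpha hk hkv (j := p ^ k - 1) (by omega) (by omega) (by omega)
    have h2 : padicValNat p (n + 2 + (p ^ k - 1)) = padicValNat p (p ^ k - 1) :=
      padicValNat_add_of_lt (by omega) hk (padicValNat_lt_of_lt_pow (by omega) (by omega))
    have h3 : k ≤ padicValNat p (n + 1 - (p ^ k - 1)) := by
      refine (padicValNat_dvd_iff_le (by omega)).1 ?_
      rw [show n + 1 - (p ^ k - 1) = n + 2 - p ^ k by omega]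
      exact Nat.dvd_sub hk dvd_rfl
    omega
  · have e : p ^ k = 1 := by omega
    have hk0 : k = 0 := by
      by_contra hk0
      have := Nat.one_lt_pow hk0 hp.out.one_lt
      omega
    rw [e] at h ⊢
    simp only [Nat.sub_self, Nat.add_zero] at h
    omega

end Valuations

theorem pow_dvd_of_le_padicValNat {p x m : ℕ} (h : m ≤ padicValNat p x) : p ^ m ∣ x :=
  (pow_dvd_pow p h).trans pow_padicValNat_dvd

theorem pow_dvd_mul_of_lt {p x y e : ℕ} (hx : e < padicValNat p x) (hy : e ≤ padicValNat p y) :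
    ((p ^ (2 * e + 1) : ℕ) : ℤ) ∣ (x : ℤ) * y := by
  rw [← Nat.cast_mul, Int.natCast_dvd_natCast, show 2 * e + 1 = e + 1 + e by ring, pow_add]
  exact mul_dvd_mul (pow_dvd_of_le_padicValNat hx) (pow_dvd_of_le_padicValNat hy)

/-! ### Parity of the valuation of the content. -/

section Parity

variable {p : ℕ} [hp : Fact p.Prime]

theorem not_pow_dvd_of_padicValNat_lt {x m : ℕ} (hx : x ≠ 0) (h : padicValNat p x < m) :
    ¬ ((p ^ m : ℕ) : ℤ) ∣ (x : ℤ) := by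
  rw [Int.natCast_dvd_natCast, padicValNat_dvd_iff_le hx]
  omega

theorem not_pow_dvd_sq {x e : ℕ} (hx : x ≠ 0) (h : padicValNat p x = e) :
    ¬ ((p ^ (2 * e + 1) : ℕ) : ℤ) ∣ (x : ℤ) ^ 2 := by
  have := not_pow_dvd_of_padicValNat_lt (p := p) (x := x ^ 2) (m := 2 * e + 1) (by positivity)
    (by rw [padicValNat.pow, h]; omega)
  rwa [Nat.cast_pow] at this

theorem padicValNat_two_mul {x : ℕ} (hx : x ≠ 0) :
    padicValNat p (2 * x) = padicValNat p 2 + padicValNat p x :=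
  padicValNat.mul two_ne_zero hx

theorem padicValNat_two_of_ne (h2 : p ≠ 2) : padicValNat p 2 = 0 :=
  padicValNat_primes h2

theorem padicValNat_gamma {n j : ℕ} (hj : 1 ≤ j) :
    padicValNat p (gamma n j) = padicValNat p 2 + padicValNat p (alpha n j) := by
  rw [gamma, if_neg (by omega), padicValNat_two_mul (alpha_pos _ _).ne']

theorem padicValNat_beta_zero (n : ℕ) :
    padicValNat p (beta n 0) + padicValNat p (n + 1) = padicValNat p (gamma n 0) := by
  have := padicValNat_beta (p := p) (Nat.zero_le n)
  simpa [gamma] using this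

/-- If p^(2e+1) divided every value, pairs would force v(β_j) > e for all j ≥ 1. In the quadruple
values all terms but γ_j² would then be divisible, using the central value when j = 1, so v(γ_j) > e
too. If β_0 alone is minimal at the centre, the central value β_0² - γ_0² already gives a
contradiction. -/
theorem exists_not_dvd_of_minimal {n e : ℕ} (hβ : ∀ j ≤ n, e ≤ padicValNat p (beta n j))
    (hγ : ∀ j ≤ n, e ≤ padicValNat p (gamma n j))
    (h : (∃ j, 1 ≤ j ∧ j ≤ n ∧ (padicValNat p (beta n j) = e ∨ padicValNat p (gamma n j) = e)) ∨
      (padicValNat p (beta n 0) = e ∧ e < padicValNat p (gamma n 0))) :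
    ∃ f : ℕ → ℤ, ¬ ((p ^ (2 * e + 1) : ℕ) : ℤ) ∣ reducedDisc n f := by
  by_contra! hall
  have hb : ∀ j, 1 ≤ j → j ≤ n → e < padicValNat p (beta n j) := fun j h1 hn =>
    lt_of_le_of_ne (hβ j hn) fun he => by
      obtain ⟨f, hf⟩ := reducedDisc_pair h1 hn
      exact not_pow_dvd_sq (beta_pos n j).ne' he.symm (hf ▸ hall f)
  have hc : ((p ^ (2 * e + 1) : ℕ) : ℤ) ∣ (beta n 0 : ℤ) ^ 2 - (gamma n 0 : ℤ) ^ 2 := by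
    obtain ⟨f, hf⟩ := reducedDisc_centre n
    exact hf ▸ hall f
  rcases h with ⟨j, h1, hn, he | he⟩ | ⟨h0, hlt⟩
  · exact (hb j h1 hn).ne' he
  · obtain ⟨f, hf⟩ := reducedDisc_quadruple h1 hn
    have hd := hf ▸ hall f
    refine not_pow_dvd_sq (gamma_pos n j).ne' he ?_
    have h2 := pow_dvd_mul_of_lt (hb j h1 hn) (hβ j hn)
    have h3 := pow_dvd_mul_of_lt (hb j h1 hn) (hβ (j - 1) (by omega))
    split_ifs at hd with hj
    · subst hj
      obtain ⟨w, hw⟩ := hd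
      obtain ⟨x, hx⟩ := h2
      obtain ⟨y, hy⟩ := h3
      obtain ⟨z, hz⟩ := hc
      exact ⟨w - x - 2 * y - z, by linear_combination hw - hx - 2 * hy - hz⟩
    · have h4 := pow_dvd_mul_of_lt (hb (j - 1) (by omega) (by omega)) (hβ (j - 1) (by omega))
      obtain ⟨w, hw⟩ := hd
      obtain ⟨x, hx⟩ := h2
      obtain ⟨y, hy⟩ := h3
      obtain ⟨z, hz⟩ := h4
      exact ⟨w - x - 2 * y - z, by linear_combination hw - hx - 2 * hy - hz⟩
  · refine not_pow_dvd_sq (beta_pos n 0).ne' h0 ?_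
    obtain ⟨x, hx⟩ := hc
    obtain ⟨y, hy⟩ := pow_dvd_mul_of_lt hlt (hγ 0 (by omega))
    exact ⟨x + y, by linear_combination hx + hy⟩

theorem padicValNat_S_of_ne_pow {n : ℕ} (hn : 1 ≤ n) (hne : ¬ ∃ k, n + 2 = p ^ k) :
    S n ≠ 0 ∧ Even (padicValNat p (S n)) := by
  classical
  have hP : ∃ e, ∃ j ≤ n, padicValNat p (beta n j) = e ∨ padicValNat p (gamma n j) = e :=
    ⟨_, 0, by omega, Or.inl rfl⟩
  obtain ⟨e, ⟨j, hjn, hj⟩, hmin⟩ : ∃ e,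
      (∃ j ≤ n, padicValNat p (beta n j) = e ∨ padicValNat p (gamma n j) = e) ∧
      ∀ m < e, ¬ ∃ j ≤ n, padicValNat p (beta n j) = m ∨ padicValNat p (gamma n j) = m :=
    ⟨Nat.find hP, Nat.find_spec hP, fun m => Nat.find_min hP⟩
  have hβ : ∀ j ≤ n, e ≤ padicValNat p (beta n j) := fun j hj => by
    by_contra! hlt
    exact hmin _ hlt ⟨j, hj, Or.inl rfl⟩
  have hγ : ∀ j ≤ n, e ≤ padicValNat p (gamma n j) := fun j hj => by
    by_contra! hlt
    exact hmin _ hlt ⟨j, hj, Or.inr rfl⟩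
  have h0 := padicValNat_beta_zero (p := p) n
  have hcases : (∃ j, 1 ≤ j ∧ j ≤ n ∧
        (padicValNat p (beta n j) = e ∨ padicValNat p (gamma n j) = e)) ∨
      (padicValNat p (beta n 0) = e ∧ e < padicValNat p (gamma n 0)) := by
    -- In the remaining case e is attained by both central weights and by no others; then p does not
    -- divide n+1.
    by_contra! hcon
    obtain ⟨hnone, hcen⟩ := hcon
    have hj0 : j = 0 := by
      by_contra hj0
      have := hnone j (by omega) hjn
      omega
    subst hj0
    have hb0 : padicValNat p (beta n 0) = e := by
      have := hβ 0 hjn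
      omega
    have hg0 := hcen hb0
    have hg0' := hγ 0 hjn
    have hn1 : padicValNat p (n + 1) = 0 := by omega
    have hα0 : padicValNat p (alpha n 0) = e := by
      have : gamma n 0 = alpha n 0 := if_pos rfl
      rw [← this]
      omega
    obtain ⟨i1, i2, i3⟩ := padicValNat_alpha_le hn (pow_padicValNat_dvd (p := p) (n := n + 2)) rfl
      fun h => hne ⟨_, h⟩
    set k := padicValNat p (n + 2) with hk
    obtain ⟨n1, n2⟩ := hnone _ i1 i2
    have b1 := hβ _ i2
    have b2 := hγ _ i2
    -- At j = p^k a noncentral weight is as small as the central ones: β_j for p = 2, where n+1-j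
    -- and 2j+1 are odd, and γ_j for odd p.
    by_cases hp2 : p = 2
    · subst hp2
      have hodd : ¬ 2 ∣ n + 1 := fun hd => (dvd_iff_padicValNat_ne_zero (by omega)).1 hd hn1
      have hk0 : k ≠ 0 := (dvd_iff_padicValNat_ne_zero (by omega)).1 (by omega)
      have heven : 2 ∣ 2 ^ k := dvd_pow_self 2 hk0
      have hb := padicValNat_beta (p := 2) i2
      rw [padicValNat.eq_zero_of_not_dvd (show ¬ 2 ∣ n + 1 - 2 ^ k by omega),
        padicValNat.eq_zero_of_not_dvd (show ¬ 2 ∣ 2 * 2 ^ k + 1 by omega)] at hb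
      omega
    · rw [padicValNat_gamma i1, padicValNat_two_of_ne hp2] at n2 b2
      omega
  have hdvd : ((p ^ (2 * e) : ℕ) : CoeffRing n) ∣ reducedDisc n (genericCoeff n) := by
    have b0 : p ^ e ∣ beta n 0 := pow_dvd_of_le_padicValNat (hβ 0 (by omega))
    have g0 : p ^ e ∣ gamma n 0 := pow_dvd_of_le_padicValNat (hγ 0 (by omega))
    have hsq : p ^ (2 * e) = p ^ e * p ^ e := by rw [two_mul, pow_add]
    refine natCast_dvd_reducedDisc (u := p ^ e) (w := p ^ e)
      (fun j _ hj => pow_dvd_of_le_padicValNat (hβ j hj))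
      (fun j _ hj => pow_dvd_of_le_padicValNat (hγ j hj)) ?_ ?_ ?_ ?_ ?_ _
    · rw [hsq, Nat.cast_mul, sq, sq]
      have b0 := Int.natCast_dvd_natCast.2 b0
      have g0 := Int.natCast_dvd_natCast.2 g0
      exact (mul_dvd_mul b0 b0).sub (mul_dvd_mul g0 g0)
    · rw [hsq]; exact mul_dvd_mul (b0.mul_left 2) dvd_rfl
    · rw [hsq, sq]
    · rw [hsq]; exact mul_dvd_mul g0 dvd_rfl
    · rw [hsq, sq]
  obtain ⟨hS, hv⟩ := padicValNat_S hdvd (exists_not_dvd_of_minimal hβ hγ hcases)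
  exact ⟨hS, by rw [hv, ← mul_add]; exact even_two_mul _⟩

theorem padicValNat_beta_zero_of_pow {n k : ℕ} (hk : 1 ≤ k) (hq : n + 2 = p ^ k) :
    padicValNat p (beta n 0) = padicValNat p (alpha n 0) := by
  have h1 : padicValNat p (n + 1) = padicValNat p 1 :=
    padicValNat_eq_of_add_eq one_ne_zero (by omega) dvd_rfl hq
      (by rw [padicValNat_one_right]; omega)
  have h := padicValNat_beta_zero (p := p) n
  rw [h1, padicValNat_one_right, gamma, if_pos rfl] at h
  exact h

theorem padicValNat_alpha_of_pow {n k : ℕ} (hq : n + 2 = p ^ k) {j : ℕ} (hj : 1 ≤ j)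
    (hjn : j ≤ n + 1) :
    padicValNat p (alpha n j) + padicValNat p j = padicValNat p (alpha n 0) + k :=
  padicValNat_alpha (dvd_of_eq hq.symm) (by rw [hq, padicValNat.prime_pow]) hj hjn (by omega)

theorem lt_padicValNat_alpha_of_pow {n k : ℕ} (hq : n + 2 = p ^ k) {j : ℕ} (hj : 1 ≤ j)
    (hjn : j ≤ n + 1) : padicValNat p (alpha n 0) < padicValNat p (alpha n j) := by
  have h := padicValNat_alpha_of_pow hq hj hjn
  have := padicValNat_lt_of_lt_pow (p := p) (y := j) (k := k) (by omega) (by omega)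
  omega

/-- The excess is k - v(j) - v(j+1) + v(2j+1). It is positive because at most one of j, j+1 is
divisible by p, and both are below p^k. -/
theorem lt_padicValNat_beta_of_pow {n k : ℕ} (hq : n + 2 = p ^ k) {j : ℕ} (hj : 1 ≤ j)
    (hjn : j ≤ n) : padicValNat p (alpha n 0) < padicValNat p (beta n j) := by
  have h := padicValNat_alpha_of_pow hq hj (by omega)
  have hb := padicValNat_beta (p := p) hjn
  have h1 := padicValNat_lt_of_lt_pow (p := p) (y := j) (k := k) (by omega) (by omega)
  have h2 := padicValNat_lt_of_lt_pow (p := p) (y := j + 1) (k := k) (by omega) (by omega)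
  have h3 : padicValNat p (n + 1 - j) = padicValNat p (j + 1) :=
    padicValNat_eq_of_add_eq (by omega) (by omega) (dvd_of_eq hq.symm) (by omega) h2
  have h4 : padicValNat p j = 0 ∨ padicValNat p (j + 1) = 0 := by
    by_contra! h
    have d1 := (dvd_iff_padicValNat_ne_zero (p := p) (by omega)).2 h.1
    have d2 := (dvd_iff_padicValNat_ne_zero (p := p) (by omega)).2 h.2
    exact hp.out.one_lt.ne' (Nat.dvd_one.1 ((Nat.dvd_add_right d1).1 d2))
  omega

theorem dvd_center_of_pow {n k : ℕ} (hk : 1 ≤ k) (hq : n + 2 = p ^ k) {c : ℕ}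
    (hc : c ∣ n * (n + 2)) :
    ((p ^ (2 * padicValNat p (alpha n 0)) * c : ℕ) : ℤ)
      ∣ (beta n 0 : ℤ) ^ 2 - (gamma n 0 : ℤ) ^ 2 := by
  have h := beta_mul (Nat.zero_le n)
  have e : (beta n 0 : ℤ) ^ 2 - (gamma n 0 : ℤ) ^ 2 = -((beta n 0 ^ 2 * (n * (n + 2)) : ℕ) : ℤ) := by
    have : gamma n 0 = beta n 0 * (n + 1) := by
      rw [gamma, if_pos rfl]
      simpa using h.symm
    rw [this]
    push_cast
    ring
  rw [e, dvd_neg, Int.natCast_dvd_natCast, mul_comm 2, pow_mul]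
  refine mul_dvd_mul (pow_dvd_pow_of_dvd (pow_dvd_of_le_padicValNat ?_) 2) hc
  rw [padicValNat_beta_zero_of_pow hk hq]

theorem padicValNat_S_of_odd_pow {n k : ℕ} (hk : 1 ≤ k) (hp2 : p ≠ 2) (hq : n + 2 = p ^ k) :
    S n ≠ 0 ∧ Odd (padicValNat p (S n)) := by
  set e := padicValNat p (alpha n 0) with he
  have hp3 : 3 ≤ p := by
    have := hp.out.two_le
    omega
  have h2 : padicValNat p 2 = 0 := padicValNat_two_of_ne hp2
  have hb0 : p ^ e ∣ beta n 0 :=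
    pow_dvd_of_le_padicValNat (padicValNat_beta_zero_of_pow hk hq).ge
  have hg0' : gamma n 0 = alpha n 0 := if_pos rfl
  have hg0 : p ^ e ∣ gamma n 0 := by rw [hg0']; exact pow_padicValNat_dvd
  have hM : p ^ (2 * e + 1) = p ^ e * p ^ (e + 1) := by rw [← pow_add]; congr 1; ring
  have hsq : p ^ (2 * e + 1) ∣ (p ^ (e + 1)) ^ 2 := by
    rw [← pow_mul]; exact pow_dvd_pow p (by omega)
  have hdvd : ((p ^ (2 * e + 1) : ℕ) : CoeffRing n) ∣ reducedDisc n (genericCoeff n) := by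
    refine natCast_dvd_reducedDisc (u := p ^ (e + 1)) (w := p ^ (e + 1))
      (fun j h1 hj => pow_dvd_of_le_padicValNat (lt_padicValNat_beta_of_pow hq h1 hj))
      (fun j h1 hj => pow_dvd_of_le_padicValNat ?_) ?_ ?_ hsq ?_ hsq _
    · rw [padicValNat_gamma h1, h2, zero_add]
      exact lt_padicValNat_alpha_of_pow hq h1 (by omega)
    · rw [pow_succ]
      exact dvd_center_of_pow hk hq ((hq ▸ dvd_pow_self p (by omega)).mul_left n)
    · rw [hM]; exact mul_dvd_mul (hb0.mul_left 2) dvd_rfl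
    · rw [hM]; exact mul_dvd_mul hg0 dvd_rfl
  -- The index j = p^(k-1) has valuation k-1, the largest possible below p^k, so γ_j exceeds the
  -- minimum by exactly 1. That j ≤ n uses p ≥ 3.
  have hj1 : 1 ≤ p ^ (k - 1) := Nat.one_le_pow _ _ hp.out.pos
  have hjn : p ^ (k - 1) ≤ n := by
    obtain ⟨l, rfl⟩ := Nat.exists_eq_add_of_le' hk
    rw [pow_succ] at hq
    rw [Nat.add_sub_cancel] at hj1 ⊢
    nlinarith
  have hv : padicValNat p (gamma n (p ^ (k - 1))) = e + 1 := by
    have := padicValNat_alpha_of_pow hq hj1 (by omega)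
    rw [padicValNat.prime_pow] at this
    rw [padicValNat_gamma hj1, h2]
    omega
  obtain ⟨hS, hval⟩ := padicValNat_S hdvd (by
    obtain ⟨f, hf⟩ := reducedDisc_triple hj1 hjn
    refine ⟨f, ?_⟩
    rw [hf, neg_mul, dvd_neg, (isUnit_neg_one.pow _).dvd_mul_left, ← Nat.cast_mul]
    refine not_pow_dvd_of_padicValNat_lt (mul_pos (gamma_pos _ _) (gamma_pos _ _)).ne' ?_
    rw [padicValNat.mul (gamma_pos _ _).ne' (gamma_pos _ _).ne', hv, hg0', ← he]
    omega)
  exact ⟨hS, by rw [hval, ← add_assoc, ← mul_add]; exact odd_two_mul_add_one _⟩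

end Parity

theorem padicValNat_S_of_two_pow {n k : ℕ} (hn : 1 ≤ n) (hq : n + 2 = 2 ^ k) :
    S n ≠ 0 ∧ Even (padicValNat 2 (S n)) := by
  set e := padicValNat 2 (alpha n 0) with he
  -- Since n ≥ 1, the power 2^k is at least 4; the factor n+2 thus supplies the extra 2² at the
  -- centre.
  obtain ⟨l, rfl⟩ : ∃ l, k = l + 2 := by
    refine Nat.exists_eq_add_of_le' ?_
    by_contra! h
    interval_cases k <;> omega
  have hk : 1 ≤ l + 2 := by omega
  have h2 : padicValNat 2 2 = 1 := padicValNat_self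
  have hb0 : 2 ^ e ∣ beta n 0 :=
    pow_dvd_of_le_padicValNat (padicValNat_beta_zero_of_pow hk hq).ge
  have hg0' : gamma n 0 = alpha n 0 := if_pos rfl
  have hg0 : 2 ^ e ∣ gamma n 0 := by rw [hg0']; exact pow_padicValNat_dvd
  have hdvd : ((2 ^ (2 * e + 2) : ℕ) : CoeffRing n) ∣ reducedDisc n (genericCoeff n) := by
    refine natCast_dvd_reducedDisc (u := 2 ^ (e + 1)) (w := 2 ^ (e + 2))
      (fun j h1 hj => pow_dvd_of_le_padicValNat (lt_padicValNat_beta_of_pow hq h1 hj))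
      (fun j h1 hj => pow_dvd_of_le_padicValNat ?_) ?_ ?_ ?_ ?_ ?_ _
    · rw [padicValNat_gamma h1, h2]
      have := lt_padicValNat_alpha_of_pow hq h1 (show j ≤ n + 1 by omega)
      omega
    · rw [pow_add]
      refine dvd_center_of_pow hk hq (Dvd.dvd.mul_left ?_ n)
      rw [hq]
      exact pow_dvd_pow 2 (by omega)
    · rw [show 2 * e + 2 = (1 + e) + (e + 1) by ring, pow_add, pow_add 2 1, pow_one]
      exact mul_dvd_mul (mul_dvd_mul dvd_rfl hb0) dvd_rfl
    · rw [← pow_mul]; exact pow_dvd_pow 2 (by omega)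
    · rw [show 2 * e + 2 = e + (e + 2) by ring, pow_add]
      exact mul_dvd_mul hg0 dvd_rfl
    · rw [← pow_mul]; exact pow_dvd_pow 2 (by omega)
  -- At j = (n+2)/2 both n+1-j and 2j+1 are odd, so β_j has the valuation of α_j, namely e+1.
  have hj1 : 1 ≤ 2 ^ (l + 1) := Nat.one_le_pow _ _ two_pos
  have hj2 : 2 ∣ 2 ^ (l + 1) := dvd_pow_self 2 (by omega)
  have hqj : n + 2 = 2 ^ (l + 1) * 2 := by rw [hq, pow_succ 2 (l + 1)]
  have hv : padicValNat 2 (beta n (2 ^ (l + 1))) = e + 1 := by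
    have ha := padicValNat_alpha_of_pow hq hj1 (by omega)
    have hb := padicValNat_beta (p := 2) (show 2 ^ (l + 1) ≤ n by omega)
    rw [padicValNat.prime_pow] at ha
    rw [padicValNat.eq_zero_of_not_dvd (show ¬ 2 ∣ n + 1 - 2 ^ (l + 1) by omega),
      padicValNat.eq_zero_of_not_dvd (show ¬ 2 ∣ 2 * 2 ^ (l + 1) + 1 by omega)] at hb
    omega
  obtain ⟨hS, hval⟩ := padicValNat_S hdvd (by
    obtain ⟨f, hf⟩ := reducedDisc_pair hj1 (show 2 ^ (l + 1) ≤ n by omega)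
    refine ⟨f, ?_⟩
    rw [hf]
    exact not_pow_dvd_sq (beta_pos _ _).ne' hv)
  refine ⟨hS, ?_⟩
  rw [hval, show 2 * e + 2 = 2 * (e + 1) by ring, ← mul_add]
  exact even_two_mul _

/-! ### Assembly over all primes. -/

theorem even_padicValNat_two_S {n : ℕ} (hn : 1 ≤ n) : S n ≠ 0 ∧ Even (padicValNat 2 (S n)) := by
  by_cases h : ∃ k, n + 2 = 2 ^ k
  · obtain ⟨k, hk⟩ := h
    exact padicValNat_S_of_two_pow hn hk
  · exact padicValNat_S_of_ne_pow hn h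

theorem odd_padicValNat_S_iff {n p : ℕ} (hn : 1 ≤ n) (hp : p.Prime) (hp2 : p ≠ 2) :
    Odd (padicValNat p (S n)) ↔ ∃ k : ℕ, n + 2 = p ^ k := by
  have : Fact p.Prime := ⟨hp⟩
  constructor
  · intro h
    by_contra hne
    exact Nat.not_even_iff_odd.2 h (padicValNat_S_of_ne_pow hn hne).2
  · rintro ⟨k, hk⟩
    refine (padicValNat_S_of_odd_pow ?_ hp2 hk).2
    -- The exponent 0 is impossible because n+2 > 1.
    by_contra! h
    interval_cases k
    rw [pow_zero] at hk
    omega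

theorem sqf_S {n : ℕ} (hn : 1 ≤ n) : sqf (S n) = a (n + 2) := by
  obtain ⟨hS, h2⟩ := even_padicValNat_two_S hn
  have hmem : ∀ q ∈ (S n).primeFactors.filter (fun q => Odd (padicValNat q (S n))),
      q.Prime ∧ q ≠ 2 ∧ ∃ k : ℕ, n + 2 = q ^ k := by
    intro q hq
    obtain ⟨hq, hodd⟩ := Finset.mem_filter.1 hq
    have hqp := Nat.prime_of_mem_primeFactors hq
    have hq2 : q ≠ 2 := by
      rintro rfl
      exact Nat.not_even_iff_odd.2 hodd h2
    exact ⟨hqp, hq2, (odd_padicValNat_S_iff hn hqp hq2).1 hodd⟩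
  by_cases h : ∃ p k : ℕ, p.Prime ∧ p ≠ 2 ∧ 1 ≤ k ∧ n + 2 = p ^ k
  · obtain ⟨p, k, hp, hp2, hk, hn2⟩ := h
    have hodd := (odd_padicValNat_S_iff hn hp hp2).2 ⟨k, hn2⟩
    have hpS : p ∣ S n := dvd_of_one_le_padicValNat hodd.pos
    have hset : (S n).primeFactors.filter (fun q => Odd (padicValNat q (S n))) = {p} := by
      refine Finset.eq_singleton_iff_unique_mem.2 ⟨?_, fun q hq => ?_⟩
      · exact Finset.mem_filter.2 ⟨Nat.mem_primeFactors.2 ⟨hp, hpS, hS⟩, hodd⟩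
      · obtain ⟨hqp, _, l, hl⟩ := hmem q hq
        refine ((Nat.prime_dvd_prime_iff_eq hp hqp).1 (hp.dvd_of_dvd_pow (n := l) ?_)).symm
        rw [← hl, hn2]
        exact dvd_pow_self p (by omega)
    rw [sqf, hset, Finset.prod_singleton, hn2, a_prime_pow hp hp2 hk]
  · rw [sqf, a, if_neg h]
    refine Finset.prod_eq_one fun q hq => (h ?_).elim
    obtain ⟨hqp, hq2, l, hl⟩ := hmem q hq
    refine ⟨q, l, hqp, hq2, ?_, hl⟩
    by_contra! hl0
    interval_cases l
    rw [pow_zero] at hl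
    omega

end QuarticInvariant

theorem theorem1 (n : ℕ) (hn : 1 ≤ n) :
    QuarticInvariant.S n ≠ 0 ∧
    Even (padicValNat 2 (QuarticInvariant.S n)) ∧
    (∀ p : ℕ, p.Prime → p ≠ 2 →
      (Odd (padicValNat p (QuarticInvariant.S n)) ↔ ∃ k : ℕ, n + 2 = p ^ k)) ∧
    QuarticInvariant.sqf (QuarticInvariant.S n) = QuarticInvariant.a (n + 2) := by
  obtain ⟨hS, h2⟩ := QuarticInvariant.even_padicValNat_two_S hn
  exact ⟨hS, h2, fun p hp hp2 => QuarticInvariant.odd_padicValNat_S_iff hn hp hp2,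
    QuarticInvariant.sqf_S hn⟩
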